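/- Let $d\ge 1$ be an integer, let $s>\frac d2$ be real, and put $n=\lfloor s-\frac d2\rfloor$. Write $\langle x\rangle=\sqrt{1+|x|^2}$. For a measurable function $V:\mathbb{R}^d\to[0,\infty)$ put $v=V^{1/2}$ and let $H_s=(-\Delta)^s-V$ be the operator on $L^2(\mathbb{R}^d)$ associated with the quadratic form $$\psi\mapsto\int_{\mathbb{R}^d}|\xi|^{2s}|\hat\psi(\xi)|^2\,d\xi-\int_{\mathbb{R}^d}V|\psi|^2\,dx,\qquad \psi\in H^s(\mathbb{R}^d),\ v\psi\in L^2(\mathbb{R}^d),$$ where $\hat\psi$ is the unitary Fourier transform of $\psi$ with kernel $(2\pi)^{-d/2}e^{-ix\cdot\xi}$. (If $v\in L^2$, the form domain is all of $H^s(\mathbb{R}^d)$.) Let $N_{<0}(H_s)$ be the number of negative eigenvalues of $H_s$, counted with multiplicity. Then there is a constant $C_{d,s}\ge 0$, depending only on $d$ and $s$, such that the following holds. (i) If $s-\frac d2\notin\mathbb{N}_0=\{0,1,2,\dots\}$, then for all $V$ such that the right-hand side is finite, $$N_{<0}(H_s)-\binom{d+n}{d}\le C_{d,s}\,\big\||x|^{s-\frac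 d2}\,v\big\|_{L^2}^2 .$$ (ii) If $s-\frac d2\in\mathbb{N}=\{1,2,\dots\}$, then for all $V$ such that the right-hand side is finite, $$N_{<0}(H_s)-\binom{d+n}{d}\le C_{d,s}\,\Big\|\langle x\rangle^{s-\frac d2}\sqrt{1+\ln\langle x\rangle}\;v\Big\|_{L^2}^2 .$$ -/

import Mathlib

open MeasureTheory
open scoped NNReal ENNReal FourierTransform ComplexConjugate

noncomputable section

namespace FractionalSchrodinger

/-- The Euclidean space `ℝ^d`. -/
abbrev Space (d : ℕ) : Type := EuclideanSpace ℝ (Fin d)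

/-- The complex Hilbert space `L²(ℝ^d)`. -/
abbrev L2 (d : ℕ) : Type := Lp ℂ 2 (volume : Measure (Space d))

/-- The square root `v = V^{1/2}` of a nonnegative potential. -/
def sqrtPot {d : ℕ} (V : Space d → ℝ≥0) (x : Space d) : ℝ := Real.sqrt (V x)

/-- The symbol `|p|^s` of `(-Δ)^{s/2}`. The Fourier transform of Mathlib has the kernel
`exp (-2πi x·ξ)`, so that `-i∇` is the Fourier multiplier `2πξ`. -/
def symbol {d : ℕ} (s : ℝ) (ξ : Space d) : ℝ := (2 * Real.pi * ‖ξ‖) ^ s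

theorem memLp_weight_add {d : ℕ} {w : Space d → ℝ} {f g : L2 d}
    (hf : MemLp (fun x => (w x : ℂ) * f x) 2 volume)
    (hg : MemLp (fun x => (w x : ℂ) * g x) 2 volume) :
    MemLp (fun x => (w x : ℂ) * (f + g : L2 d) x) 2 volume := by
  refine (memLp_congr_ae ?_).mp (hf.add hg)
  filter_upwards [Lp.coeFn_add f g] with x hx
  simp only [hx, Pi.add_apply]
  ring

theorem memLp_weight_smul {d : ℕ} {w : Space d → ℝ} (c : ℂ) {f : L2 d}
    (hf : MemLp (fun x => (w x : ℂ) * f x) 2 volume) :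
    MemLp (fun x => (w x : ℂ) * (c • f : L2 d) x) 2 volume := by
  refine (memLp_congr_ae ?_).mp (hf.const_mul c)
  filter_upwards [Lp.coeFn_smul c f] with x hx
  simp only [hx, Pi.smul_apply, smul_eq_mul]
  ring

theorem memLp_weight_zero {d : ℕ} {w : Space d → ℝ} :
    MemLp (fun x => (w x : ℂ) * (0 : L2 d) x) 2 volume := by
  simp

/-- The form domain of `H_s = (-Δ)^s - V`, `V ≥ 0`: all `ψ` in the Sobolev space `H^s(ℝ^d)`
(`ψ ∈ L²` and `|p|^s ψ̂ ∈ L²`) with `V^{1/2} ψ ∈ L²`. When `s > d/2` and `V` is integrable, this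
is the whole of `H^s(ℝ^d)`, whose elements are bounded functions. -/
def formDomain {d : ℕ} (s : ℝ) (V : Space d → ℝ≥0) : Submodule ℂ (L2 d) where
  carrier := {ψ | MemLp (fun ξ => (symbol s ξ : ℂ) * (𝓕 ψ : L2 d) ξ) 2 volume ∧
    MemLp (fun x => (sqrtPot V x : ℂ) * ψ x) 2 volume}
  add_mem' := by
    rintro f g ⟨hf, hf'⟩ ⟨hg, hg'⟩
    refine ⟨?_, memLp_weight_add hf' hg'⟩
    rw [FourierTransform.fourier_add]
    exact memLp_weight_add hf hg
  zero_mem' := by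
    refine ⟨?_, memLp_weight_zero⟩
    have h : (𝓕 (0 : L2 d) : L2 d) = 0 := (Lp.fourierTransformₗᵢ (Space d) ℂ).map_zero
    rw [h]
    exact memLp_weight_zero
  smul_mem' := by
    rintro c f ⟨hf, hf'⟩
    refine ⟨?_, memLp_weight_smul c hf'⟩
    rw [FourierTransform.fourier_smul]
    exact memLp_weight_smul c hf

/-- The sesquilinear form of `H_s = (-Δ)^s - V`, antilinear in the first argument:
`q(φ, ψ) = ∫ |p|^{2s} conj(φ̂) ψ̂ - ∫ V conj(φ) ψ`. -/
def form {d : ℕ} (s : ℝ) (V : Space d → ℝ≥0) (φ ψ : L2 d) : ℂ :=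
  (∫ ξ, (symbol (2 * s) ξ : ℂ) * (conj ((𝓕 φ : L2 d) ξ) * (𝓕 ψ : L2 d) ξ)) -
    ∫ x, ((V x : ℝ) : ℂ) * (conj (φ x) * ψ x)

theorem integrable_weight {d : ℕ} {w W : Space d → ℝ} (hW : ∀ x, W x = w x * w x) {f g : L2 d}
    (hf : MemLp (fun x => (w x : ℂ) * f x) 2 volume)
    (hg : MemLp (fun x => (w x : ℂ) * g x) 2 volume) :
    Integrable (fun x => (W x : ℂ) * (conj (f x) * g x)) volume := by
  refine (MemLp.integrable_mul hf.star hg).congr (Filter.Eventually.of_forall fun x => ?_)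
  simp only [Pi.mul_apply, Pi.star_apply, hW x, RCLike.star_def, map_mul, Complex.conj_ofReal,
    Complex.ofReal_mul]
  ring

theorem integral_weight_add {d : ℕ} {w W : Space d → ℝ} (hW : ∀ x, W x = w x * w x)
    {f g h : L2 d} (hf : MemLp (fun x => (w x : ℂ) * f x) 2 volume)
    (hg : MemLp (fun x => (w x : ℂ) * g x) 2 volume)
    (hh : MemLp (fun x => (w x : ℂ) * h x) 2 volume) :
    ∫ x, (W x : ℂ) * (conj (f x) * (g + h : L2 d) x) =
      (∫ x, (W x : ℂ) * (conj (f x) * g x)) + ∫ x, (W x : ℂ) * (conj (f x) * h x) := by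
  rw [← integral_add (integrable_weight hW hf hg) (integrable_weight hW hf hh)]
  refine integral_congr_ae ?_
  filter_upwards [Lp.coeFn_add g h] with x hx
  simp only [hx, Pi.add_apply]
  ring

theorem integral_weight_smul {d : ℕ} (W : Space d → ℝ) (c : ℂ) (f g : L2 d) :
    ∫ x, (W x : ℂ) * (conj (f x) * (c • g : L2 d) x) =
      c * ∫ x, (W x : ℂ) * (conj (f x) * g x) := by
  rw [← integral_const_mul]
  refine integral_congr_ae ?_
  filter_upwards [Lp.coeFn_smul c g] with x hx
  simp only [hx, Pi.smul_apply, smul_eq_mul]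
  ring

theorem symbol_two_mul {d : ℕ} (s : ℝ) (hs : 0 ≤ s) (ξ : Space d) :
    symbol (2 * s) ξ = symbol s ξ * symbol s ξ := by
  have h : (0 : ℝ) ≤ 2 * Real.pi * ‖ξ‖ := by positivity
  unfold symbol
  rw [two_mul s, Real.rpow_add_of_nonneg h hs hs]

theorem pot_eq {d : ℕ} (V : Space d → ℝ≥0) (x : Space d) :
    (V x : ℝ) = sqrtPot V x * sqrtPot V x :=
  (Real.mul_self_sqrt (V x).coe_nonneg).symm

theorem form_add {d : ℕ} {s : ℝ} (hs : 0 ≤ s) {V : Space d → ℝ≥0} {φ ψ χ : L2 d}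
    (hφ : φ ∈ formDomain s V) (hψ : ψ ∈ formDomain s V) (hχ : χ ∈ formDomain s V) :
    form s V φ (ψ + χ) = form s V φ ψ + form s V φ χ := by
  unfold form
  rw [FourierTransform.fourier_add,
    integral_weight_add (symbol_two_mul s hs) hφ.1 hψ.1 hχ.1,
    integral_weight_add (W := fun x => (V x : ℝ)) (pot_eq V) hφ.2 hψ.2 hχ.2]
  ring

theorem form_smul {d : ℕ} (s : ℝ) (V : Space d → ℝ≥0) (c : ℂ) (φ ψ : L2 d) :
    form s V φ (c • ψ) = c * form s V φ ψ := by
  unfold form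
  rw [FourierTransform.fourier_smul, integral_weight_smul,
    integral_weight_smul (fun x => (V x : ℝ))]
  ring

/-- The operator `H_s = (-Δ)^s - V` on `L²(ℝ^d)`, `s ≥ 0`, `V ≥ 0`, through its graph. It is the
operator associated with the form `q`: `ψ` is in its domain and `H_s ψ = η` if `ψ` is in the form
domain of `q` and `q(φ, ψ) = ⟨φ, η⟩` for all `φ` in the form domain. (The vector `η` is unique
when the form domain is dense in `L²(ℝ^d)`, for which it suffices that `V` is integrable on
compact subsets of `ℝ^d ∖ {0}`.) -/
def schrodinger {d : ℕ} (s : ℝ≥0) (V : Space d → ℝ≥0) : Submodule ℂ (L2 d × L2 d) where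
  carrier := {p | p.1 ∈ formDomain s V ∧
    ∀ φ ∈ formDomain s V, form s V φ p.1 = inner ℂ φ p.2}
  add_mem' := by
    rintro ⟨ψ, η⟩ ⟨ψ', η'⟩ ⟨h₁, h₂⟩ ⟨h₁', h₂'⟩
    refine ⟨add_mem h₁ h₁', fun φ hφ => ?_⟩
    have e : form s V φ (ψ + ψ') = form s V φ ψ + form s V φ ψ' := form_add s.2 hφ h₁ h₁'
    simp only [Prod.mk_add_mk, e, inner_add_right, h₂ φ hφ, h₂' φ hφ]
  zero_mem' := by
    refine ⟨zero_mem _, fun φ _ => ?_⟩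
    have e : form s V φ ((0 : ℂ) • (0 : L2 d)) = 0 * form s V φ 0 := form_smul s V 0 φ 0
    simpa using e
  smul_mem' := by
    rintro c ⟨ψ, η⟩ ⟨h₁, h₂⟩
    refine ⟨Submodule.smul_mem _ c h₁, fun φ hφ => ?_⟩
    have e : form s V φ (c • ψ) = c * form s V φ ψ := form_smul s V c φ ψ
    simp only [Prod.smul_mk, e, inner_smul_right, h₂ φ hφ]

/-- The eigenspace `ker (A - E)` of an operator `A` that is given by its graph. -/
def eigenspace {d : ℕ} (A : Submodule ℂ (L2 d × L2 d)) (E : ℝ) : Submodule ℂ (L2 d) :=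
  A.comap (LinearMap.prod LinearMap.id ((E : ℂ) • LinearMap.id))

/-- `N_{<0}(A)`, the number of negative eigenvalues of `A`, counted with their multiplicities:
the sum of `dim ker (A - E)` over all `E < 0`. -/
def numNegEigenvalues {d : ℕ} (A : Submodule ℂ (L2 d × L2 d)) : ℝ≥0∞ :=
  ∑' E : Set.Iio (0 : ℝ), ((Module.rank ℂ (eigenspace A E)).toENat : ℝ≥0∞)

/-- The Japanese bracket `⟨x⟩ = (1 + |x|²)^{1/2}`. -/
def japanese {d : ℕ} (x : Space d) : ℝ := Real.sqrt (1 + ‖x‖ ^ 2)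

end FractionalSchrodinger

end

noncomputable section

namespace FractionalSchrodinger

/-! ### Eigenvalue counting by orthonormal eigenvectors -/

section Counting

variable {d : ℕ}

/-! The argument is a trace bound on a subspace of finite codimension. Eigenvectors for negative
eigenvalues span a space on which the form is negative definite (`form_self_span_neg`). Imposing `N`
linear conditions on that space costs at most `N` dimensions. Suppose that under these conditions
point values are represented as `ψ(x) = ⟨g_x, |p|^s ψ̂⟩`. Normalize finitely many `ψ_i` so that the
vectors `|p|^s ψ̂_i` are orthonormal: negativity gives `1 < ∫ V |ψ_i|²`, and Bessel's inequality
gives `∑ |ψ_i(x)|² ≤ ‖g_x‖²`. Hence the remaining dimension is at most `∫ V ‖g_x‖²`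
(`finrank_le_lintegral`).

The conditions are the vanishing of the moments of `ψ̂` of order at most `n`, one for each monomial
of degree at most `n` in `d` variables, which yields the binomial coefficient. They permit
subtracting from `exp (2πi x·ξ)`, in the Fourier inversion formula, its Taylor polynomial of degree
`n` (`coeFn_eq_integral_expRemainder`), so `g_x` is the conjugate of the remainder divided by
`|p|^s`. The remainder is `O((|x||ξ|)^(n+1))` and also `O((|x||ξ|)^n)`. For `n < s - d/2 < n + 1`,
using the first bound on `|ξ| ≤ 1/|x|` and the second beyond it gives `‖g_x‖² ≤ C |x|^(2s-d)`.

If `s - d/2 = n ≥ 1`, the moments of order `n` need not converge absolutely at infinity, so the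
top-order term is kept only on the unit ball. Outside the ball the Taylor polynomial has degree `n -
1`; the shell `1/⟨x⟩ < |ξ| ≤ 1` is scale invariant and produces the logarithm. -/

theorem conj_form (s : ℝ) (V : Space d → ℝ≥0) (φ ψ : L2 d) :
    conj (form s V φ ψ) = form s V ψ φ := by
  unfold form
  rw [map_sub, ← integral_conj, ← integral_conj]
  congr 1 <;>
  · congr 1
    ext x
    simp only [map_mul, Complex.conj_ofReal, Complex.conj_conj]
    ring

theorem mem_eigenspace {A : Submodule ℂ (L2 d × L2 d)} {E : ℝ} {ψ : L2 d} :
    ψ ∈ eigenspace A E ↔ (ψ, (E : ℂ) • ψ) ∈ A := Iff.rfl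

/-- By Hermitian symmetry, the two ways of evaluating the form on a pair of eigenvectors differ by
the factor `E' - E`. Thus orthonormal families from different eigenspaces can be merged into one. -/
theorem inner_eigenspace_eq_zero {s : ℝ≥0} {V : Space d → ℝ≥0} {E E' : ℝ} (hE : E ≠ E')
    {φ ψ : L2 d} (hφ : φ ∈ eigenspace (schrodinger s V) E)
    (hψ : ψ ∈ eigenspace (schrodinger s V) E') : inner ℂ φ ψ = 0 := by
  rw [mem_eigenspace] at hφ hψ
  have h₁ : form s V φ ψ = E' * inner ℂ φ ψ := by
    rw [hψ.2 φ hφ.1, inner_smul_right]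
  have h₂ : form s V ψ φ = E * inner ℂ ψ φ := by
    rw [hφ.2 ψ hψ.1, inner_smul_right]
  have h₃ := congrArg conj h₂
  rw [conj_form, h₁, map_mul, Complex.conj_ofReal, inner_conj_symm] at h₃
  have h₄ : ((E' : ℂ) - E) * inner ℂ φ ψ = 0 := by rw [sub_mul, h₃, sub_self]
  refine (mul_eq_zero.mp h₄).resolve_left fun h => hE ?_
  exact_mod_cast (sub_eq_zero.mp h).symm

theorem exists_orthonormal_of_le_rank {H : Type*} [NormedAddCommGroup H] [InnerProductSpace ℂ H]
    {n : ℕ} (h : (n : Cardinal) ≤ Module.rank ℂ H) : ∃ v : Fin n → H, Orthonormal ℂ v := by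
  obtain ⟨u, hu⟩ := Module.le_rank_iff.mp h
  exact ⟨_, InnerProductSpace.gramSchmidtNormed_orthonormal hu⟩

/-- The negative eigenvalues can be counted through finite orthonormal families of
eigenvectors. -/
theorem numNegEigenvalues_le_of_orthonormal {s : ℝ≥0} {V : Space d → ℝ≥0} {B : ℝ≥0∞}
    (h : ∀ (ι : Type) [Fintype ι] (v : ι → L2 d) (E : ι → ℝ), Orthonormal ℂ v →
      (∀ i, E i < 0) → (∀ i, v i ∈ eigenspace (schrodinger s V) (E i)) →
      (Fintype.card ι : ℝ≥0∞) ≤ B) :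
    numNegEigenvalues (schrodinger s V) ≤ B := by
  have key : ∀ (S : Finset (Set.Iio (0 : ℝ))) (k : Set.Iio (0 : ℝ) → ℕ),
      (∀ E, (k E : Cardinal) ≤ Module.rank ℂ (eigenspace (schrodinger s V) E)) →
      ∑ E ∈ S, (k E : ℝ≥0∞) ≤ B := by
    intro S k hk
    choose u hu using fun E => exists_orthonormal_of_le_rank (hk E)
    have hfam : OrthogonalFamily ℂ (fun E : S => eigenspace (schrodinger s V) (E : Set.Iio (0 : ℝ)))
        fun E => (eigenspace (schrodinger s V) (E : Set.Iio (0 : ℝ))).subtypeₗᵢ := by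
      intro E E' hE φ ψ
      exact inner_eigenspace_eq_zero (fun h => hE (Subtype.ext (Subtype.ext h))) φ.2 ψ.2
    have hon := hfam.orthonormal_sigma_orthonormal (v_family := fun E : S => u E) fun E => hu E
    have := h (Σ E : S, Fin (k E)) (fun a => (u a.1 a.2 : L2 d)) (fun a => a.1) hon
      (fun a => Set.mem_Iio.mp a.1.1.2) fun a => (u a.1 a.2).2
    rw [Fintype.card_sigma] at this
    simp only [Fintype.card_fin] at this
    rw [← Finset.sum_coe_sort]
    exact_mod_cast this
  unfold numNegEigenvalues
  rw [ENNReal.tsum_eq_iSup_sum]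
  refine iSup_le fun S => ?_
  by_cases hfin : ∀ E : Set.Iio (0 : ℝ),
      Cardinal.toENat (Module.rank ℂ (eigenspace (schrodinger s V) E)) ≠ ⊤
  · choose k hk using fun E => ENat.ne_top_iff_exists.mp (hfin E)
    refine le_trans (le_of_eq (Finset.sum_congr rfl fun E _ => ?_)) (key S k fun E => ?_)
    · rw [← hk E]; rfl
    · exact Cardinal.natCast_le_toENat.mp (hk E).le
  -- An eigenspace of infinite rank contains orthonormal families of every finite size, which forces
  -- `B = ⊤`.
  · push Not at hfin
    obtain ⟨E, hE⟩ := hfin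
    have hB : B = ⊤ := by
      refine ENNReal.eq_top_of_forall_nnreal_le fun r => ?_
      obtain ⟨m, hm⟩ := exists_nat_ge r
      classical
      have := key {E} (fun E' => if E' = E then m else 0) fun E' => by
        split_ifs with h
        · subst h
          exact Cardinal.natCast_le_toENat.mp (hE ▸ le_top)
        · simp
      simp only [Finset.sum_singleton, if_true] at this
      exact le_trans (by exact_mod_cast hm) this
    rw [hB]
    exact le_top

/-- The form is diagonal in an orthonormal family of eigenvectors: its value at `∑ c_i v_i` is `∑
E_i |c_i|²`. -/
theorem form_self_span_neg {s : ℝ≥0} {V : Space d → ℝ≥0} {ι : Type*} [Fintype ι]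
    {v : ι → L2 d} {E : ι → ℝ} (hv : Orthonormal ℂ v) (hE : ∀ i, E i < 0)
    (hmem : ∀ i, v i ∈ eigenspace (schrodinger s V) (E i)) {ψ : L2 d}
    (hψ : ψ ∈ Submodule.span ℂ (Set.range v)) (h0 : ψ ≠ 0) : (form s V ψ ψ).re < 0 := by
  obtain ⟨c, rfl⟩ := (Submodule.mem_span_range_iff_exists_fun ℂ).mp hψ
  set ψ := ∑ i, c i • v i with hψdef
  have hdom : ∀ i, v i ∈ formDomain s V := fun i => (mem_eigenspace.mp (hmem i)).1
  have hψd : ψ ∈ formDomain s V :=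
    Submodule.sum_mem _ fun i _ => Submodule.smul_mem _ _ (hdom i)
  have hsum : ∀ S : Finset ι, form s V ψ (∑ i ∈ S, c i • v i) =
      ∑ i ∈ S, c i * form s V ψ (v i) := by
    classical
    intro S
    induction S using Finset.induction_on with
    | empty =>
      have := form_smul s V 0 ψ 0
      simpa using this
    | insert i S hi ih =>
      have h₁ : c i • v i ∈ formDomain s V := Submodule.smul_mem _ _ (hdom i)
      have h₂ : ∑ j ∈ S, c j • v j ∈ formDomain s V :=
        Submodule.sum_mem _ fun j _ => Submodule.smul_mem _ _ (hdom j)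
      have h₃ : form s V ψ (c i • v i + ∑ j ∈ S, c j • v j) =
          form s V ψ (c i • v i) + form s V ψ (∑ j ∈ S, c j • v j) := form_add s.2 hψd h₁ h₂
      rw [Finset.sum_insert hi, Finset.sum_insert hi, h₃, ih, form_smul]
  have hval : form s V ψ ψ = ((∑ i, E i * ‖c i‖ ^ 2 : ℝ) : ℂ) := by
    conv_lhs => arg 4; rw [hψdef]
    rw [hsum]
    push_cast
    refine Finset.sum_congr rfl fun i _ => ?_
    rw [(mem_eigenspace.mp (hmem i)).2 ψ hψd, inner_smul_right, hψdef, hv.inner_left_fintype,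
      ← Complex.mul_conj']
    ring
  rw [hval, Complex.ofReal_re]
  have hc : ∃ i, c i ≠ 0 := by
    by_contra! h
    exact h0 (Finset.sum_eq_zero fun i _ => by rw [h i, zero_smul])
  obtain ⟨i, hi⟩ := hc
  refine Finset.sum_neg' (fun j _ => ?_) ⟨i, Finset.mem_univ i, ?_⟩
  · exact mul_nonpos_of_nonpos_of_nonneg (hE j).le (by positivity)
  · exact mul_neg_of_neg_of_pos (hE i) (by positivity)

end Counting

/-! ### The trace bound on a subspace of finite codimension -/

section Trace

variable {d : ℕ}

/-- The map `ψ ↦ |p|^s ψ̂` on the form domain. -/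
def symbolFourier (s : ℝ) (V : Space d → ℝ≥0) : formDomain s V →ₗ[ℂ] L2 d where
  toFun ψ := ψ.2.1.toLp _
  map_add' φ ψ := by
    rw [← MemLp.toLp_add φ.2.1 ψ.2.1]
    refine MemLp.toLp_congr _ _ ?_
    have h : (𝓕 ((φ + ψ : formDomain s V) : L2 d) : L2 d) = 𝓕 (φ : L2 d) + 𝓕 (ψ : L2 d) := by
      rw [Submodule.coe_add, FourierTransform.fourier_add]
    filter_upwards [Lp.coeFn_add (𝓕 (φ : L2 d) : L2 d) (𝓕 (ψ : L2 d))] with x hx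
    simp only [h, hx, Pi.add_apply]
    ring
  map_smul' c ψ := by
    rw [RingHom.id_apply, ← MemLp.toLp_const_smul c ψ.2.1]
    refine MemLp.toLp_congr _ _ ?_
    have h : (𝓕 ((c • ψ : formDomain s V) : L2 d) : L2 d) = c • 𝓕 (ψ : L2 d) := by
      rw [Submodule.coe_smul, FourierTransform.fourier_smul]
    filter_upwards [Lp.coeFn_smul c (𝓕 (ψ : L2 d) : L2 d)] with x hx
    simp only [h, hx, Pi.smul_apply, smul_eq_mul]
    ring

theorem coeFn_symbolFourier {s : ℝ} {V : Space d → ℝ≥0} (ψ : formDomain s V) :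
    symbolFourier s V ψ =ᵐ[volume] fun ξ => (symbol s ξ : ℂ) * (𝓕 (ψ : L2 d) : L2 d) ξ :=
  ψ.2.1.coeFn_toLp

theorem form_self {s : ℝ} (hs : 0 ≤ s) {V : Space d → ℝ≥0} (ψ : formDomain s V) :
    (form s V ψ ψ).re =
      ‖symbolFourier s V ψ‖ ^ 2 - ∫ x, (V x : ℝ) * ‖(ψ : L2 d) x‖ ^ 2 := by
  have h₁ : (∫ ξ, (symbol (2 * s) ξ : ℂ) *
      (conj ((𝓕 (ψ : L2 d) : L2 d) ξ) * (𝓕 (ψ : L2 d) : L2 d) ξ)) =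
      inner ℂ (symbolFourier s V ψ) (symbolFourier s V ψ) := by
    rw [L2.inner_def]
    refine integral_congr_ae ?_
    filter_upwards [coeFn_symbolFourier ψ] with ξ hξ
    rw [hξ, symbol_two_mul s hs, RCLike.inner_apply]
    simp only [map_mul, Complex.conj_ofReal, Complex.ofReal_mul]
    ring
  have h₂ : (∫ x, ((V x : ℝ) : ℂ) * (conj ((ψ : L2 d) x) * (ψ : L2 d) x)) =
      ((∫ x, (V x : ℝ) * ‖(ψ : L2 d) x‖ ^ 2 : ℝ) : ℂ) := by
    refine Eq.trans ?_ integral_complex_ofReal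
    congr 1
    ext x
    rw [mul_comm (conj _), Complex.mul_conj']
    push_cast
    rfl
  unfold form
  rw [h₁, h₂, Complex.sub_re, Complex.ofReal_re, inner_self_eq_norm_sq_to_K]
  norm_cast

theorem integrable_pot_mul_sq {s : ℝ} {V : Space d → ℝ≥0} (ψ : formDomain s V) :
    Integrable (fun x => (V x : ℝ) * ‖(ψ : L2 d) x‖ ^ 2) volume := by
  refine (ψ.2.2.integrable_norm_pow two_ne_zero).congr (Filter.Eventually.of_forall fun x => ?_)
  simp only [norm_mul, mul_pow, pot_eq V x, Complex.norm_real, Real.norm_eq_abs, sq_abs]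
  ring

/-- If the form of `(-Δ)^s - V` is negative on a space `K`, and the value of `ψ ∈ K` at `x` is
the scalar product of `g x` and `|p|^s ψ̂`, then `∫ V(x) ‖g x‖² dx` bounds the dimension
of `K`. -/
theorem finrank_le_lintegral {s : ℝ} (hs : 0 ≤ s) {V : Space d → ℝ≥0}
    (hV : AEMeasurable V volume) (K : Submodule ℂ (formDomain s V)) [FiniteDimensional ℂ K]
    (hneg : ∀ ψ ∈ K, ψ ≠ 0 → (form s V ψ ψ).re < 0) (g : Space d → L2 d)
    (hrep : ∀ ψ ∈ K, ∀ᵐ x, (ψ : L2 d) x = inner ℂ (g x) (symbolFourier s V ψ)) :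
    (Module.finrank ℂ K : ℝ≥0∞) ≤ ∫⁻ x, V x * ‖g x‖ₑ ^ 2 := by
  set T := (symbolFourier s V).domRestrict K with hT
  -- The representation by `g` recovers `ψ` from `|p|^s ψ̂`, so no dimension is lost in passing to
  -- the range of `T`.
  have hinj : Function.Injective T := by
    rw [← LinearMap.ker_eq_bot, LinearMap.ker_eq_bot']
    intro ψ hψ
    have h0 : symbolFourier s V ψ = 0 := hψ
    have : ((ψ : formDomain s V) : L2 d) = 0 := by
      rw [Lp.eq_zero_iff_ae_eq_zero]
      filter_upwards [hrep ψ ψ.2] with x hx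
      rw [hx, h0, inner_zero_right]
      rfl
    exact Subtype.ext (Subtype.ext this)
  let b := stdOrthonormalBasis ℂ (LinearMap.range T)
  have hb : Orthonormal ℂ fun i => (b i : L2 d) :=
    b.orthonormal.comp_linearIsometry (LinearMap.range T).subtypeₗᵢ
  choose ψ hψ using fun i => LinearMap.mem_range.mp (b i).2
  have hψ' : ∀ i, symbolFourier s V (ψ i) = b i := hψ
  -- Each `ψ i` has kinetic energy `1`, as `b i` is a unit vector; negativity of the form makes the
  -- potential energy exceed it.
  have hone : ∀ i, (1 : ℝ≥0∞) ≤ ∫⁻ x, V x * ‖((ψ i : formDomain s V) : L2 d) x‖ₑ ^ 2 := by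
    intro i
    have hne : (ψ i : formDomain s V) ≠ 0 := by
      intro h
      have := hψ' i
      rw [h, map_zero] at this
      exact hb.ne_zero i this.symm
    have h₁ := hneg _ (ψ i).2 hne
    rw [form_self hs, hψ' i, hb.1 i] at h₁
    have h₂ := ofReal_integral_eq_lintegral_ofReal (integrable_pot_mul_sq (ψ i : formDomain s V))
      (Filter.Eventually.of_forall fun x => by positivity)
    calc (1 : ℝ≥0∞) = ENNReal.ofReal 1 := ENNReal.ofReal_one.symm
      _ ≤ _ := ENNReal.ofReal_le_ofReal (by linarith)
      _ = _ := h₂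
      _ = _ := by
        congr 1
        ext x
        rw [ENNReal.ofReal_mul (V x).coe_nonneg, ENNReal.ofReal_coe_nnreal,
          ENNReal.ofReal_pow (norm_nonneg _), ofReal_norm]
  rw [← LinearMap.finrank_range_of_inj hinj]
  calc (Module.finrank ℂ (LinearMap.range T) : ℝ≥0∞)
      = ∑ _i : Fin (Module.finrank ℂ (LinearMap.range T)), 1 := by simp
    _ ≤ ∑ i, ∫⁻ x, V x * ‖((ψ i : formDomain s V) : L2 d) x‖ₑ ^ 2 :=
      Finset.sum_le_sum fun i _ => hone i
    _ = ∫⁻ x, ∑ i, V x * ‖((ψ i : formDomain s V) : L2 d) x‖ₑ ^ 2 := by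
      refine (lintegral_finsetSum' _ fun i _ => ?_).symm
      exact hV.coe_nnreal_ennreal.mul
        ((Lp.aestronglyMeasurable ((ψ i : formDomain s V) : L2 d)).enorm.pow_const 2)
    _ ≤ ∫⁻ x, V x * ‖g x‖ₑ ^ 2 := by
      refine lintegral_mono_ae ?_
      filter_upwards [ae_all_iff.mpr fun i => hrep (ψ i) (ψ i).2] with x hx
      rw [← Finset.mul_sum]
      gcongr
      -- Bessel's inequality for `g x` against the orthonormal vectors `b i`.
      have h := hb.sum_inner_products_le (g x) (s := Finset.univ)
      calc ∑ i, ‖((ψ i : formDomain s V) : L2 d) x‖ₑ ^ 2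
          = ∑ i, ENNReal.ofReal (‖inner ℂ (b i : L2 d) (g x)‖ ^ 2) := by
            refine Finset.sum_congr rfl fun i _ => ?_
            rw [hx i, hψ' i, ← ofReal_norm, norm_inner_symm, ENNReal.ofReal_pow (norm_nonneg _)]
        _ = ENNReal.ofReal (∑ i, ‖inner ℂ (b i : L2 d) (g x)‖ ^ 2) :=
            (ENNReal.ofReal_sum_of_nonneg fun i _ => by positivity).symm
        _ ≤ ENNReal.ofReal (‖g x‖ ^ 2) := ENNReal.ofReal_le_ofReal h
        _ = ‖g x‖ₑ ^ 2 := by rw [ENNReal.ofReal_pow (norm_nonneg _), ofReal_norm]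

/-- The trace bound for the number of negative eigenvalues, off a subspace of codimension at most
`card κ` in the form domain. -/
theorem numNegEigenvalues_le_card_add_lintegral {s : ℝ≥0} {V : Space d → ℝ≥0}
    (hV : AEMeasurable V volume) {κ : Type*} [Fintype κ] (L : formDomain s V →ₗ[ℂ] κ → ℂ)
    (g : Space d → L2 d) (hrep : ∀ ψ ∈ LinearMap.ker L, ∀ᵐ x,
      (ψ : L2 d) x = inner ℂ (g x) (symbolFourier s V ψ)) :
    numNegEigenvalues (schrodinger s V) ≤ Fintype.card κ + ∫⁻ x, V x * ‖g x‖ₑ ^ 2 := by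
  refine numNegEigenvalues_le_of_orthonormal fun ι _ v E hv hE hmem => ?_
  let u : ι → formDomain s V := fun i => ⟨v i, (mem_eigenspace.mp (hmem i)).1⟩
  let W := Submodule.span ℂ (Set.range u)
  have hWv : ∀ ψ ∈ W, (ψ : L2 d) ∈ Submodule.span ℂ (Set.range v) := by
    intro ψ hψ
    have h := Submodule.mem_map_of_mem (f := (formDomain s V).subtype) hψ
    rw [Submodule.map_span, ← Set.range_comp] at h
    exact h
  have hu : LinearIndependent ℂ u :=
    LinearIndependent.of_comp (formDomain s V).subtype hv.linearIndependent
  have hW : Module.finrank ℂ W = Fintype.card ι := finrank_span_eq_card hu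
  have : FiniteDimensional ℂ W := FiniteDimensional.span_of_finite ℂ (Set.finite_range u)
  let LW := L.domRestrict W
  let K := (LinearMap.ker LW).map W.subtype
  have hK : Module.finrank ℂ K = Module.finrank ℂ (LinearMap.ker LW) :=
    LinearEquiv.finrank_eq (Submodule.equivMapOfInjective _ W.injective_subtype _).symm
  have : FiniteDimensional ℂ K :=
    inferInstanceAs (FiniteDimensional ℂ ((LinearMap.ker LW).map W.subtype))
  have hKW : ∀ ψ ∈ K, ψ ∈ W ∧ L ψ = 0 := by
    rintro _ ⟨ψ, hψ, rfl⟩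
    exact ⟨ψ.2, hψ⟩
  -- Rank-nullity on the span of the eigenvectors: the kernel of `L` there has dimension at least
  -- `card ι - card κ`.
  have hrank := LW.finrank_range_add_finrank_ker
  have hrange : Module.finrank ℂ (LinearMap.range LW) ≤ Fintype.card κ :=
    (Submodule.finrank_le _).trans_eq (Module.finrank_fintype_fun_eq_card ℂ)
  have hmain := finrank_le_lintegral (s := (s : ℝ)) s.2 hV K
    (fun ψ hψ h0 => form_self_span_neg hv hE hmem (hWv ψ (hKW ψ hψ).1)
      fun h => h0 (Subtype.ext h)) g fun ψ hψ => hrep ψ (hKW ψ hψ).2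
  have hcard : Fintype.card ι ≤ Fintype.card κ + Module.finrank ℂ K := by omega
  calc (Fintype.card ι : ℝ≥0∞) ≤ Fintype.card κ + Module.finrank ℂ K := by exact_mod_cast hcard
    _ ≤ _ := add_le_add le_rfl hmain

end Trace

theorem eLpNorm_two_sq {α E : Type*} [MeasurableSpace α] [NormedAddCommGroup E] (μ : Measure α)
    (f : α → E) : eLpNorm f 2 μ ^ 2 = ∫⁻ x, ‖f x‖ₑ ^ 2 ∂μ := by
  have h := eLpNorm_nnreal_pow_eq_lintegral (μ := μ) (f := f) (p := 2) two_ne_zero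
  norm_num at h
  exact h

/-! ### Pointwise Fourier inversion in the form domain -/

section Inversion

variable {d : ℕ}

/-- Fourier inversion for a square integrable function with an integrable Fourier transform. -/
theorem coeFn_eq_fourierInv (f : L2 d) (hf : Integrable (𝓕 f : L2 d) volume) :
    ∀ᵐ x, f x = 𝓕⁻ ((𝓕 f : L2 d) : Space d → ℂ) x := by
  have hcont : Continuous (𝓕⁻ ((𝓕 f : L2 d) : Space d → ℂ)) :=
    VectorFourier.fourierIntegral_continuous (L := -innerₗ (Space d)) Real.continuous_fourierChar
      (continuous_inner (𝕜 := ℝ) (E := Space d)).neg hf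
  -- Both sides are compared as distributions. The `L²` inversion formula moves the inverse
  -- transform onto the test function, and the exchange formula for integrable functions moves it
  -- back.
  refine ae_eq_of_integral_contDiff_smul_eq ((Lp.memLp f).locallyIntegrable (by norm_num))
    hcont.locallyIntegrable fun g hg hgc => ?_
  have hg₁ : HasCompactSupport (Complex.ofRealCLM ∘ g) := hgc.comp_left rfl
  have hg₂ := Complex.ofRealCLM.contDiff.comp hg
  set G := hg₁.toSchwartzMap hg₂ with hG
  have h₁ : (f : TemperedDistribution (Space d) ℂ) G = ∫ x, g x • f x := by
    rw [Lp.toTemperedDistribution_apply]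
    rfl
  have h₂ := Lp.fourierInv_toTemperedDistribution_eq (𝓕 f : L2 d)
  rw [FourierTransform.fourierInv_fourier_eq] at h₂
  rw [← h₁, ← h₂, TemperedDistribution.fourierInv_apply, Lp.toTemperedDistribution_apply]
  have h₃ := VectorFourier.integral_fourierIntegral_smul_eq_flip (L := -innerₗ (Space d))
    (μ := volume) (ν := volume) Real.continuous_fourierChar
    (continuous_inner (𝕜 := ℝ) (E := Space d)).neg G.integrable hf
  rw [SchwartzMap.fourierInv_coe]
  refine h₃.trans ?_
  have : (-innerₗ (Space d)).flip = -innerₗ (Space d) := by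
    ext x y
    simp [real_inner_comm y x]
  rw [this]
  rfl

theorem coeFn_eq_integral_exp (f : L2 d) (hf : Integrable (𝓕 f : L2 d) volume) :
    ∀ᵐ x, f x = ∫ ξ, Complex.exp (2 * Real.pi * Complex.I * (inner ℝ x ξ : ℝ)) *
      (𝓕 f : L2 d) ξ := by
  filter_upwards [coeFn_eq_fourierInv f hf] with x hx
  rw [hx, Real.fourierInv_eq']
  congr 1
  ext ξ
  rw [real_inner_comm, smul_eq_mul]
  congr 2
  push_cast
  ring

theorem symbol_pos {s : ℝ} {ξ : Space d} (hξ : ξ ≠ 0) : 0 < symbol s ξ :=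
  Real.rpow_pos_of_pos (mul_pos Real.two_pi_pos (norm_pos_iff.mpr hξ)) s

theorem norm_rpow_le_symbol {s : ℝ} (hs : 0 ≤ s) (ξ : Space d) : ‖ξ‖ ^ s ≤ symbol s ξ :=
  Real.rpow_le_rpow (norm_nonneg _)
    (le_mul_of_one_le_left (norm_nonneg _) (by linarith [Real.pi_gt_three])) hs

theorem measurable_symbol (s : ℝ) : Measurable (symbol (d := d) s) :=
  (measurable_norm.const_mul _).pow_const s

/-- The Fourier transform of a function in `H^s` has integrable moments of order below
`s - d / 2`. -/
theorem integrable_norm_pow_mul_fourier {s : ℝ} (hs : 0 ≤ s) {V : Space d → ℝ≥0} {k : ℕ}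
    (hk : (k : ℝ) < s - d / 2) {ψ : L2 d} (hψ : ψ ∈ formDomain s V) :
    Integrable (fun ξ => ((‖ξ‖ ^ k : ℝ) : ℂ) * (𝓕 ψ : L2 d) ξ) volume := by
  set F : L2 d := 𝓕 ψ
  -- Cauchy–Schwarz: `|ξ|^k |ψ̂|` is dominated by this weight, square integrable because `2 (s - k)
  -- > d`, times a multiple of `|ψ̂| + |p|^s |ψ̂|`.
  have h₁ : MemLp (fun ξ : Space d => (1 + ‖ξ‖) ^ (k - s)) 2 volume := by
    rw [memLp_two_iff_integrable_sq
      ((measurable_norm.const_add 1).pow_const _).aestronglyMeasurable]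
    have := integrable_one_add_norm (E := Space d) (μ := volume) (r := 2 * (s - k)) (by
      rw [finrank_euclideanSpace_fin]; linarith)
    refine this.congr (Filter.Eventually.of_forall fun ξ => ?_)
    simp only
    rw [← Real.rpow_natCast, ← Real.rpow_mul (by positivity)]
    congr 1
    push_cast
    ring
  have h₂ : MemLp (fun ξ => ((2 : ℝ) ^ s) * (‖F ξ‖ + ‖(symbol s ξ : ℂ) * F ξ‖)) 2 volume :=
    ((Lp.memLp F).norm.add hψ.1.norm).const_mul _
  refine (h₁.integrable_mul h₂).mono' ?_ (Filter.Eventually.of_forall fun ξ => ?_)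
  · exact (Continuous.aestronglyMeasurable (by fun_prop)).mul (Lp.aestronglyMeasurable F)
  · have hsym := norm_rpow_le_symbol hs ξ
    have hsym0 : 0 ≤ symbol s ξ := le_trans (by positivity) hsym
    have hle : (1 + ‖ξ‖) ^ s ≤ 2 ^ s * (1 + symbol s ξ) := by
      rcases le_total ‖ξ‖ 1 with h | h
      · calc (1 + ‖ξ‖) ^ s ≤ 2 ^ s := Real.rpow_le_rpow (by positivity) (by linarith) hs
          _ ≤ 2 ^ s * (1 + symbol s ξ) := le_mul_of_one_le_right (by positivity) (by linarith)
      · calc (1 + ‖ξ‖) ^ s ≤ (2 * ‖ξ‖) ^ s := Real.rpow_le_rpow (by positivity) (by linarith) hs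
          _ = 2 ^ s * ‖ξ‖ ^ s := Real.mul_rpow (by norm_num) (norm_nonneg _)
          _ ≤ 2 ^ s * (1 + symbol s ξ) := by gcongr; linarith
    have hpow : ‖ξ‖ ^ k ≤ (1 + ‖ξ‖) ^ (k - s) * (1 + ‖ξ‖) ^ s := by
      rw [← Real.rpow_add (by positivity), sub_add_cancel, Real.rpow_natCast]
      gcongr
      linarith
    simp only [Pi.mul_apply, norm_mul, Complex.norm_real, Real.norm_eq_abs, abs_pow, abs_norm,
      abs_of_nonneg hsym0]
    calc ‖ξ‖ ^ k * ‖F ξ‖ ≤ ((1 + ‖ξ‖) ^ (k - s) * (2 ^ s * (1 + symbol s ξ))) * ‖F ξ‖ := by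
          gcongr
          exact hpow.trans (by gcongr)
      _ = _ := by ring

end Inversion

/-! ### Vanishing moments and subtraction of the Taylor polynomial -/

section Moments

variable {d : ℕ}

/-- The monomial in the coordinates of `ξ` that is given by a multiset of indices, where `none`
stands for the factor `1`. -/
def monomial (m : Multiset (Option (Fin d))) (ξ : Space d) : ℝ :=
  (m.map fun o => o.elim 1 fun i => ξ i).prod

/-- The degree of `monomial m`. -/
def monomialDegree (m : Multiset (Option (Fin d))) : ℕ := m.countP fun o => o.isSome

theorem continuous_monomial (m : Multiset (Option (Fin d))) : Continuous (monomial m) := by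
  refine continuous_multiset_prod _ fun o _ => ?_
  cases o with
  | none => exact continuous_const
  | some i => exact EuclideanSpace.proj i |>.continuous

theorem abs_monomial_le (m : Multiset (Option (Fin d))) (ξ : Space d) :
    |monomial m ξ| ≤ ‖ξ‖ ^ monomialDegree m := by
  induction m using Multiset.induction_on with
  | empty => simp [monomial, monomialDegree]
  | cons o m ih =>
    unfold monomial monomialDegree at *
    cases o with
    | none => simpa using ih
    | some i =>
      have hi : |ξ i| ≤ ‖ξ‖ := PiLp.norm_apply_le ξ i
      simp only [Multiset.map_cons, Multiset.prod_cons, Option.elim_some, abs_mul,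
        Option.isSome_some, Multiset.countP_cons_of_pos, pow_succ']
      gcongr

/-- The moments `∫ χ_k(ξ) ξ^α ψ̂(ξ) dξ` of the Fourier transform for all `|α| = k ≤ n`. -/
def moments {s : ℝ} {V : Space d → ℝ≥0} (n : ℕ) (χ : ℕ → Space d → ℝ)
    (hint : ∀ ψ ∈ formDomain s V, ∀ k ≤ n,
      Integrable (fun ξ => ((‖ξ‖ ^ k * χ k ξ : ℝ) : ℂ) * (𝓕 ψ : L2 d) ξ) volume)
    (hmeas : ∀ k, Measurable (χ k)) :
    formDomain s V →ₗ[ℂ] Sym (Option (Fin d)) n → ℂ where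
  toFun ψ m := ∫ ξ, ((monomial m.1 ξ * χ (monomialDegree m.1) ξ : ℝ) : ℂ) * (𝓕 (ψ : L2 d) : L2 d) ξ
  map_add' φ ψ := by
    have hI : ∀ (ψ : formDomain s V) (m : Sym (Option (Fin d)) n),
        Integrable (fun ξ => ((monomial m.1 ξ * χ (monomialDegree m.1) ξ : ℝ) : ℂ) *
          (𝓕 (ψ : L2 d) : L2 d) ξ) volume := by
      intro ψ m
      refine (hint ψ ψ.2 (monomialDegree m.1)
        ((Multiset.countP_le_card _ _).trans_eq m.2)).mono ?_
        (Filter.Eventually.of_forall fun ξ => ?_)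
      · exact (Complex.measurable_ofReal.comp ((continuous_monomial m.1).measurable.mul
          (hmeas _))).aestronglyMeasurable.mul (Lp.aestronglyMeasurable _)
      · simp only [norm_mul, Complex.norm_real, Real.norm_eq_abs, abs_pow, abs_norm]
        gcongr
        exact abs_monomial_le m.1 ξ
    ext m
    rw [Pi.add_apply, ← integral_add (hI φ m) (hI ψ m)]
    refine integral_congr_ae ?_
    have h : (𝓕 ((φ + ψ : formDomain s V) : L2 d) : L2 d) = 𝓕 (φ : L2 d) + 𝓕 (ψ : L2 d) := by
      rw [Submodule.coe_add, FourierTransform.fourier_add]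
    filter_upwards [Lp.coeFn_add (𝓕 (φ : L2 d) : L2 d) (𝓕 (ψ : L2 d))] with x hx
    simp only [h, hx, Pi.add_apply]
    ring
  map_smul' c ψ := by
    ext m
    rw [Pi.smul_apply, RingHom.id_apply, smul_eq_mul, ← integral_const_mul]
    refine integral_congr_ae ?_
    have h : (𝓕 ((c • ψ : formDomain s V) : L2 d) : L2 d) = c • 𝓕 (ψ : L2 d) := by
      rw [Submodule.coe_smul, FourierTransform.fourier_smul]
    filter_upwards [Lp.coeFn_smul c (𝓕 (ψ : L2 d) : L2 d)] with x hx
    simp only [h, hx, Pi.smul_apply, smul_eq_mul]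
    ring

theorem integral_prod_coord_eq_zero {s : ℝ} {V : Space d → ℝ≥0} {n : ℕ} {χ : ℕ → Space d → ℝ}
    {hint : ∀ ψ ∈ formDomain s V, ∀ k ≤ n,
      Integrable (fun ξ => ((‖ξ‖ ^ k * χ k ξ : ℝ) : ℂ) * (𝓕 ψ : L2 d) ξ) volume}
    {hmeas : ∀ k, Measurable (χ k)} {ψ : formDomain s V}
    (hψ : ψ ∈ LinearMap.ker (moments n χ hint hmeas)) {k : ℕ} (hk : k ≤ n) (f : Fin k → Fin d) :
    ∫ ξ, (((∏ j, ξ (f j)) * χ k ξ : ℝ) : ℂ) * (𝓕 (ψ : L2 d) : L2 d) ξ = 0 := by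
  -- Padding with `none` brings a monomial of degree `k ≤ n` to the fixed size `n` without changing
  -- its value or degree.
  let m : Multiset (Option (Fin d)) :=
    (Finset.univ.val.map fun j => some (f j)) + Multiset.replicate (n - k) none
  have hm : m.card = n := by simp [m, hk]
  have h₁ : ∀ ξ, monomial m ξ = ∏ j, ξ (f j) := by
    intro ξ
    simp [monomial, m, Finset.prod]
    rfl
  have h₂ : monomialDegree m = k := by
    rw [monomialDegree, Multiset.countP_add, Multiset.countP_map, Multiset.countP_eq_zero.mpr
      fun o ho => by simp [Multiset.eq_of_mem_replicate ho]]
    simp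
  have := congrFun (LinearMap.mem_ker.mp hψ) ⟨m, hm⟩
  change ∫ ξ, ((monomial m ξ * χ (monomialDegree m) ξ : ℝ) : ℂ) * (𝓕 (ψ : L2 d) : L2 d) ξ = 0
    at this
  simpa only [h₁, h₂] using this

/-- Summing over ordered tuples instead of multi-indices avoids multinomial coefficients; each
summand separates `x` from `ξ`. -/
theorem inner_pow_eq_sum (x ξ : Space d) (k : ℕ) :
    (inner ℝ x ξ : ℝ) ^ k = ∑ f : Fin k → Fin d, (∏ j, x (f j)) * ∏ j, ξ (f j) := by
  have : (inner ℝ x ξ : ℝ) = ∑ i, x i * ξ i := by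
    simp [PiLp.inner_apply, mul_comm]
  rw [this, Finset.sum_pow', Fintype.piFinset_univ]
  simp only [Finset.prod_mul_distrib]

theorem integral_inner_pow_eq_zero {s : ℝ} {V : Space d → ℝ≥0} {n : ℕ} {χ : ℕ → Space d → ℝ}
    {hint : ∀ ψ ∈ formDomain s V, ∀ k ≤ n,
      Integrable (fun ξ => ((‖ξ‖ ^ k * χ k ξ : ℝ) : ℂ) * (𝓕 ψ : L2 d) ξ) volume}
    {hmeas : ∀ k, Measurable (χ k)} {ψ : formDomain s V}
    (hψ : ψ ∈ LinearMap.ker (moments n χ hint hmeas)) {k : ℕ} (hk : k ≤ n) (x : Space d) :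
    ∫ ξ, (((inner ℝ x ξ) ^ k * χ k ξ : ℝ) : ℂ) * (𝓕 (ψ : L2 d) : L2 d) ξ = 0 := by
  have hI : ∀ f : Fin k → Fin d, Integrable (fun ξ : Space d =>
      (((∏ j, ξ (f j)) * χ k ξ : ℝ) : ℂ) * (𝓕 (ψ : L2 d) : L2 d) ξ) volume := by
    intro f
    refine (hint ψ ψ.2 k hk).mono ?_ (Filter.Eventually.of_forall fun ξ => ?_)
    · refine (Complex.measurable_ofReal.comp (Measurable.mul ?_
          (hmeas _))).aestronglyMeasurable.mul (Lp.aestronglyMeasurable _)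
      exact Continuous.measurable (by fun_prop)
    · simp only [norm_mul, Complex.norm_real, Real.norm_eq_abs, abs_pow, abs_norm,
        Finset.abs_prod]
      gcongr
      calc ∏ j, |ξ (f j)| ≤ ∏ _j : Fin k, ‖ξ‖ :=
            Finset.prod_le_prod (fun _ _ => abs_nonneg _) fun j _ => PiLp.norm_apply_le ξ (f j)
        _ = ‖ξ‖ ^ k := by simp
  calc ∫ ξ, (((inner ℝ x ξ) ^ k * χ k ξ : ℝ) : ℂ) * (𝓕 (ψ : L2 d) : L2 d) ξ
      = ∫ ξ, ∑ f : Fin k → Fin d, ((∏ j, x (f j) : ℝ) : ℂ) *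
          ((((∏ j, ξ (f j)) * χ k ξ : ℝ) : ℂ) * (𝓕 (ψ : L2 d) : L2 d) ξ) := by
        congr 1
        ext ξ
        rw [inner_pow_eq_sum, Finset.sum_mul]
        push_cast
        rw [Finset.sum_mul]
        exact Finset.sum_congr rfl fun f _ => by ring
    _ = 0 := by
        rw [integral_finsetSum _ fun f _ => (hI f).const_mul _]
        refine Finset.sum_eq_zero fun f _ => ?_
        rw [integral_const_mul, integral_prod_coord_eq_zero hψ hk, mul_zero]

/-- The remainder of the Taylor expansion of `exp (2πi x·ξ)` up to the order `n`, in which the term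
of order `k` carries the cutoff `χ k`. -/
def expRemainder (n : ℕ) (χ : ℕ → Space d → ℝ) (x ξ : Space d) : ℂ :=
  Complex.exp (2 * Real.pi * Complex.I * (inner ℝ x ξ : ℝ)) -
    ∑ k ∈ Finset.range (n + 1),
      (χ k ξ : ℂ) * ((2 * Real.pi * Complex.I * (inner ℝ x ξ : ℝ)) ^ k / k.factorial)

theorem measurable_expRemainder {n : ℕ} {χ : ℕ → Space d → ℝ} (hmeas : ∀ k, Measurable (χ k))
    (x : Space d) : Measurable (expRemainder n χ x) := by
  unfold expRemainder
  refine Measurable.sub (Continuous.measurable (by fun_prop))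
    (Finset.measurable_fun_sum _ fun k _ => ?_)
  exact (Complex.measurable_ofReal.comp (hmeas k)).mul (Continuous.measurable (by fun_prop))

/-- Every Taylor term removed from the exponential integrates to zero against `ψ̂`, being for fixed
`x` a combination of vanishing moments with the same cutoff. -/
theorem coeFn_eq_integral_expRemainder {s : ℝ} (hs : 0 ≤ s) (hds : (d : ℝ) / 2 < s)
    {V : Space d → ℝ≥0} {n : ℕ} {χ : ℕ → Space d → ℝ}
    {hint : ∀ ψ ∈ formDomain s V, ∀ k ≤ n,
      Integrable (fun ξ => ((‖ξ‖ ^ k * χ k ξ : ℝ) : ℂ) * (𝓕 ψ : L2 d) ξ) volume}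
    {hmeas : ∀ k, Measurable (χ k)} {ψ : formDomain s V}
    (hψ : ψ ∈ LinearMap.ker (moments n χ hint hmeas)) :
    ∀ᵐ x, (ψ : L2 d) x = ∫ ξ, expRemainder n χ x ξ * (𝓕 (ψ : L2 d) : L2 d) ξ := by
  have hF : Integrable (𝓕 (ψ : L2 d) : L2 d) volume := by
    have := integrable_norm_pow_mul_fourier hs (k := 0) (by push_cast; linarith) ψ.2
    simpa using this
  filter_upwards [coeFn_eq_integral_exp _ hF] with x hx
  rw [hx]
  have h₁ : Integrable (fun ξ => Complex.exp (2 * Real.pi * Complex.I * (inner ℝ x ξ : ℝ)) *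
      (𝓕 (ψ : L2 d) : L2 d) ξ) volume := by
    refine hF.bdd_mul (c := 1) (Continuous.aestronglyMeasurable (by fun_prop))
      (Filter.Eventually.of_forall fun ξ => ?_)
    rw [Complex.norm_exp]
    simp
  have h₂ : ∀ k ∈ Finset.range (n + 1), Integrable (fun ξ =>
      ((2 * Real.pi * Complex.I) ^ k / k.factorial : ℂ) *
        ((((inner ℝ x ξ) ^ k * χ k ξ : ℝ) : ℂ) * (𝓕 (ψ : L2 d) : L2 d) ξ)) volume := by
    intro k hk
    refine Integrable.const_mul ?_ _
    refine ((hint ψ ψ.2 k (Nat.lt_succ_iff.mp (Finset.mem_range.mp hk))).const_mul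
      ((‖x‖ ^ k : ℝ) : ℂ)).mono ?_ (Filter.Eventually.of_forall fun ξ => ?_)
    · refine (Complex.measurable_ofReal.comp (Measurable.mul ?_
          (hmeas _))).aestronglyMeasurable.mul (Lp.aestronglyMeasurable _)
      exact Continuous.measurable (by fun_prop)
    · simp only [norm_mul, Complex.norm_real, Real.norm_eq_abs, abs_pow, abs_norm]
      rw [← mul_assoc, ← mul_assoc, ← mul_pow]
      gcongr
      exact abs_real_inner_le_norm x ξ
  have h₃ : ∀ ξ, expRemainder n χ x ξ * (𝓕 (ψ : L2 d) : L2 d) ξ =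
      Complex.exp (2 * Real.pi * Complex.I * (inner ℝ x ξ : ℝ)) * (𝓕 (ψ : L2 d) : L2 d) ξ -
      ∑ k ∈ Finset.range (n + 1), ((2 * Real.pi * Complex.I) ^ k / k.factorial : ℂ) *
        ((((inner ℝ x ξ) ^ k * χ k ξ : ℝ) : ℂ) * (𝓕 (ψ : L2 d) : L2 d) ξ) := by
    intro ξ
    rw [expRemainder, sub_mul, Finset.sum_mul]
    congr 1
    refine Finset.sum_congr rfl fun k _ => ?_
    push_cast
    rw [mul_pow _ ((inner ℝ x ξ : ℝ) : ℂ)]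
    ring
  simp only [h₃]
  rw [integral_sub h₁ (integrable_finsetSum _ h₂), integral_finsetSum _ h₂]
  rw [Finset.sum_eq_zero fun k hk => ?_, sub_zero]
  rw [integral_const_mul, integral_inner_pow_eq_zero hψ
    (Nat.lt_succ_iff.mp (Finset.mem_range.mp hk)), mul_zero]

/-- Stars and bars: multisets of size `n` in `d + 1` symbols are the monomials of degree at most `n`
in `d` variables. -/
theorem card_sym_option_fin (d n : ℕ) :
    Fintype.card (Sym (Option (Fin d)) n) = (d + n).choose d := by
  rw [Sym.card_sym_eq_choose, Fintype.card_option, Fintype.card_fin]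
  rw [show d + 1 + n - 1 = d + n by omega, Nat.choose_symm_add]

/-- A weighted bound for the remainder `expRemainder`, uniform in `x`, gives a bound for the number
of negative eigenvalues. -/
theorem numNegEigenvalues_le_of_expRemainder (hd : 1 ≤ d) {s : ℝ≥0} (hds : (d : ℝ) / 2 < s)
    {V : Space d → ℝ≥0} (hV : AEMeasurable V volume) {n : ℕ} {χ : ℕ → Space d → ℝ}
    (hint : ∀ ψ ∈ formDomain s V, ∀ k ≤ n,
      Integrable (fun ξ => ((‖ξ‖ ^ k * χ k ξ : ℝ) : ℂ) * (𝓕 ψ : L2 d) ξ) volume)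
    (hmeas : ∀ k, Measurable (χ k)) {C : ℝ≥0} {w : Space d → ℝ}
    (hw : ∀ x ≠ 0, eLpNorm (fun ξ => expRemainder n χ x ξ / (symbol s ξ : ℂ)) 2 volume ^ 2 ≤
      C * ‖w x‖ₑ ^ 2) :
    numNegEigenvalues (schrodinger s V) ≤ ((d + n).choose d : ℝ≥0∞) +
      C * eLpNorm (fun x => w x * sqrtPot V x) 2 volume ^ 2 := by
  classical
  have : NeZero d := ⟨by omega⟩
  have hne : ∀ᵐ x : Space d, x ≠ 0 := Measure.ae_ne volume 0
  -- The conjugate compensates for the antilinearity of the inner product in its first argument.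
  let γ : Space d → Space d → ℂ := fun x ξ => conj (expRemainder n χ x ξ / (symbol s ξ : ℂ))
  have hγnorm : ∀ x, eLpNorm (γ x) 2 volume =
      eLpNorm (fun ξ => expRemainder n χ x ξ / (symbol s ξ : ℂ)) 2 volume := fun x =>
    eLpNorm_congr_norm_ae (Filter.Eventually.of_forall fun ξ => by simp [γ])
  have hγ : ∀ x ≠ 0, MemLp (γ x) 2 volume := by
    intro x hx
    refine ⟨?_, ?_⟩
    · refine Measurable.aestronglyMeasurable ?_
      exact Complex.continuous_conj.measurable.comp ((measurable_expRemainder hmeas x).div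
        (Complex.measurable_ofReal.comp (measurable_symbol s)))
    · rw [hγnorm x]
      have h : C * ‖w x‖ₑ ^ 2 < ⊤ := by
        rw [Real.enorm_eq_ofReal_abs]
        exact ENNReal.mul_lt_top ENNReal.coe_lt_top (ENNReal.pow_lt_top ENNReal.ofReal_lt_top)
      by_contra hcon
      rw [not_lt, top_le_iff] at hcon
      have := (hw x hx).trans_lt h
      rw [hcon] at this
      simp at this
  let g : Space d → L2 d := fun x => if h : x ≠ 0 then (hγ x h).toLp (γ x) else 0
  have hmain := numNegEigenvalues_le_card_add_lintegral hV (moments n χ hint hmeas) g ?_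
  · rw [card_sym_option_fin] at hmain
    refine hmain.trans (add_le_add le_rfl ?_)
    rw [eLpNorm_two_sq, ← lintegral_const_mul' _ _ ENNReal.coe_ne_top]
    refine lintegral_mono_ae ?_
    filter_upwards [hne] with x hx
    have h₁ : ‖g x‖ₑ ^ 2 ≤ C * ‖w x‖ₑ ^ 2 := by
      simp only [g, dif_pos hx]
      rw [Lp.enorm_toLp, hγnorm]
      exact hw x hx
    calc (V x : ℝ≥0∞) * ‖g x‖ₑ ^ 2 ≤ V x * (C * ‖w x‖ₑ ^ 2) := by gcongr
      _ = C * (‖w x‖ₑ ^ 2 * V x) := by ring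
      _ = C * ‖w x * sqrtPot V x‖ₑ ^ 2 := by
        rw [enorm_mul, mul_pow]
        congr 2
        rw [sqrtPot, Real.enorm_eq_ofReal (Real.sqrt_nonneg _),
          ← ENNReal.ofReal_pow (Real.sqrt_nonneg _), Real.sq_sqrt (V x).coe_nonneg,
          ENNReal.ofReal_coe_nnreal]
  · intro ψ hψ
    filter_upwards [hne, coeFn_eq_integral_expRemainder s.2 hds hψ] with x hx hrep
    rw [hrep, L2.inner_def]
    refine integral_congr_ae ?_
    have hgx : g x = (hγ x hx).toLp (γ x) := dif_pos hx
    rw [hgx]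
    filter_upwards [hne, (hγ x hx).coeFn_toLp, coeFn_symbolFourier ψ] with ξ hξ h₁ h₂
    have hsym : (symbol s ξ : ℂ) ≠ 0 := by
      exact_mod_cast (symbol_pos hξ).ne'
    rw [h₁, h₂, RCLike.inner_apply]
    simp only [γ, Complex.conj_conj]
    field_simp

end Moments

/-! ### Pointwise bounds for the Taylor remainder -/

section Remainder

/-- For `‖z‖ ≤ 1` Taylor's estimate gives the higher power, which is the smaller one. For `‖z‖ ≥ 1`
the triangle inequality gives the lower power: `|exp z| = 1` and the `n + 1` Taylor terms are each
at most `‖z‖ ^ n`, whence `n + 2`. -/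
theorem norm_exp_sub_sum_le {z : ℂ} (hz : z.re = 0) (n : ℕ) :
    ‖Complex.exp z - ∑ k ∈ Finset.range (n + 1), z ^ k / k.factorial‖ ≤ (n + 2) * ‖z‖ ^ n ∧
    ‖Complex.exp z - ∑ k ∈ Finset.range (n + 1), z ^ k / k.factorial‖ ≤
      (n + 2) * ‖z‖ ^ (n + 1) := by
  have hfac : ∀ k : ℕ, (1 : ℝ) ≤ k.factorial := fun k => by
    exact_mod_cast Nat.one_le_iff_ne_zero.mpr k.factorial_ne_zero
  rcases le_total ‖z‖ 1 with h | h
  · have h₁ := Complex.exp_bound h n.succ_pos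
    have h₂ : ((n + 1).succ : ℝ) * ((n + 1).factorial * (n + 1 : ℕ) : ℝ)⁻¹ ≤ n + 2 := by
      have : (1 : ℝ) ≤ (n + 1).factorial * (n + 1 : ℕ) :=
        one_le_mul_of_one_le_of_one_le (hfac _) (by exact_mod_cast n.succ_pos)
      calc ((n + 1).succ : ℝ) * ((n + 1).factorial * (n + 1 : ℕ) : ℝ)⁻¹
          ≤ (n + 1).succ * 1 := by
            gcongr
            exact inv_le_one_of_one_le₀ this
        _ = n + 2 := by push_cast; ring
    have h₃ : ‖Complex.exp z - ∑ k ∈ Finset.range (n + 1), z ^ k / k.factorial‖ ≤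
        (n + 2) * ‖z‖ ^ (n + 1) := by
      refine h₁.trans ?_
      rw [mul_comm]
      gcongr
    refine ⟨h₃.trans ?_, h₃⟩
    gcongr ?_ * ?_
    exact pow_le_pow_of_le_one (norm_nonneg _) h n.le_succ
  · have h₁ : ‖Complex.exp z - ∑ k ∈ Finset.range (n + 1), z ^ k / k.factorial‖ ≤
        (n + 2) * ‖z‖ ^ n := by
      have hn : 1 ≤ ‖z‖ ^ n := one_le_pow₀ h
      calc ‖Complex.exp z - ∑ k ∈ Finset.range (n + 1), z ^ k / k.factorial‖
          ≤ ‖Complex.exp z‖ + ∑ k ∈ Finset.range (n + 1), ‖z ^ k / (k.factorial : ℂ)‖ :=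
            (norm_sub_le _ _).trans (add_le_add le_rfl (norm_sum_le _ _))
        _ ≤ 1 + ∑ _k ∈ Finset.range (n + 1), ‖z‖ ^ n := by
            gcongr with k hk
            · rw [Complex.norm_exp, hz, Real.exp_zero]
            · rw [norm_div, norm_pow, Complex.norm_natCast]
              exact (div_le_self (by positivity) (hfac k)).trans
                (pow_le_pow_right₀ h (Nat.lt_succ_iff.mp (Finset.mem_range.mp hk)))
        _ ≤ (n + 2) * ‖z‖ ^ n := by
            rw [Finset.sum_const, Finset.card_range, nsmul_eq_mul]
            push_cast
            linarith
    refine ⟨h₁, h₁.trans ?_⟩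
    gcongr
    exact n.le_succ

variable {d : ℕ}

theorem norm_two_pi_inner_le {x ξ : Space d} {r : ℝ} (hr : ‖x‖ ≤ r) :
    ‖(2 * Real.pi * Complex.I * (inner ℝ x ξ : ℝ) : ℂ)‖ ≤ 2 * Real.pi * (r * ‖ξ‖) := by
  simp only [norm_mul, Complex.norm_I, Complex.norm_real, Real.norm_eq_abs, Complex.norm_ofNat,
    abs_of_pos Real.pi_pos, mul_one]
  gcongr
  exact (abs_real_inner_le_norm x ξ).trans (by gcongr)

/-- At a frequency where the cutoffs keep exactly the orders up to `m`, this is the Taylor remainder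
of order `m`. The radius `r` may be `‖x‖` or the larger `⟨x⟩`; the constant depends on `n` alone, so
it serves both `m = n` and `m = n - 1`. -/
theorem norm_expRemainder_le {n m : ℕ} (hm : m ≤ n) {χ : ℕ → Space d → ℝ} {x ξ : Space d}
    {r : ℝ} (hr : ‖x‖ ≤ r) (h₁ : ∀ k ≤ m, χ k ξ = 1) (h₀ : ∀ k ≤ n, m < k → χ k ξ = 0) :
    ‖expRemainder n χ x ξ‖ ≤ (n + 2) * (2 * Real.pi) ^ (n + 1) * (r * ‖ξ‖) ^ m ∧
    ‖expRemainder n χ x ξ‖ ≤ (n + 2) * (2 * Real.pi) ^ (n + 1) * (r * ‖ξ‖) ^ (m + 1) := by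
  have hr0 : 0 ≤ r := (norm_nonneg x).trans hr
  have hpi : (1 : ℝ) ≤ 2 * Real.pi := by linarith [Real.pi_gt_three]
  set z : ℂ := 2 * Real.pi * Complex.I * (inner ℝ x ξ : ℝ) with hz
  have hre : z.re = 0 := by simp [hz]
  have hG : expRemainder n χ x ξ =
      Complex.exp z - ∑ k ∈ Finset.range (m + 1), z ^ k / k.factorial := by
    unfold expRemainder
    congr 1
    rw [← Finset.sum_subset (Finset.range_mono (Nat.succ_le_succ hm))]
    · refine Finset.sum_congr rfl fun k hk => ?_
      rw [h₁ k (Nat.lt_succ_iff.mp (Finset.mem_range.mp hk)), Complex.ofReal_one, one_mul]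
    · intro k hk hk'
      rw [Finset.mem_range] at hk hk'
      rw [h₀ k (by omega) (by omega), Complex.ofReal_zero, zero_mul]
  have hle : ∀ p ≤ n + 1, (m + 2 : ℝ) * ‖z‖ ^ p ≤
      (n + 2) * (2 * Real.pi) ^ (n + 1) * (r * ‖ξ‖) ^ p := by
    intro p hp
    calc (m + 2 : ℝ) * ‖z‖ ^ p ≤ (n + 2) * (2 * Real.pi * (r * ‖ξ‖)) ^ p := by
          gcongr
          exact norm_two_pi_inner_le hr
      _ = (n + 2) * (2 * Real.pi) ^ p * (r * ‖ξ‖) ^ p := by rw [mul_pow]; ring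
      _ ≤ _ := by
          gcongr
  rw [hG]
  have := norm_exp_sub_sum_le hre m
  exact ⟨this.1.trans (hle m (by omega)), this.2.trans (hle (m + 1) (by omega))⟩

end Remainder

/-! ### Radial integration and the weighted bounds -/

section Radial

variable {d : ℕ}

/-- The area of the unit sphere in `ℝ^d`. -/
def sphereArea (d : ℕ) : ℝ := d * (volume : Measure (Space d)).real (Metric.ball 0 1)

theorem sphereArea_nonneg (d : ℕ) : 0 ≤ sphereArea d :=
  mul_nonneg d.cast_nonneg measureReal_nonneg

theorem setLIntegral_norm_rpow (hd : 1 ≤ d) {S : Set ℝ} (hS : MeasurableSet S) {a : ℝ}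
    (hint : IntegrableOn (fun y : ℝ => y ^ (a + d - 1)) (S ∩ Set.Ioi 0)) :
    ∫⁻ ξ in {ξ : Space d | ‖ξ‖ ∈ S}, ENNReal.ofReal (‖ξ‖ ^ a) =
      ENNReal.ofReal (sphereArea d * ∫ y in S ∩ Set.Ioi 0, y ^ (a + d - 1)) := by
  have : Nontrivial (Space d) := by
    have : Nonempty (Fin d) := ⟨⟨0, hd⟩⟩
    infer_instance
  set f : ℝ → ℝ := S.indicator fun y => y ^ a with hf
  have hfd : ∀ y ∈ Set.Ioi (0 : ℝ), y ^ (d - 1) • f y =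
      S.indicator (fun y => y ^ (a + d - 1)) y := by
    intro y hy
    by_cases hyS : y ∈ S
    · rw [hf, Set.indicator_of_mem hyS, Set.indicator_of_mem hyS, smul_eq_mul,
        ← Real.rpow_natCast, ← Real.rpow_add hy, Nat.cast_sub hd]
      congr 1
      push_cast
      ring
    · rw [hf, Set.indicator_of_notMem hyS, Set.indicator_of_notMem hyS, smul_zero]
  have hI : Integrable (fun ξ : Space d => f ‖ξ‖) volume := by
    rw [integrable_fun_norm_addHaar (μ := (volume : Measure (Space d))),
      finrank_euclideanSpace_fin, integrableOn_congr_fun hfd measurableSet_Ioi,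
      IntegrableOn, integrable_indicator_iff hS, IntegrableOn, Measure.restrict_restrict hS]
    exact hint
  have hval : ∫ ξ : Space d, f ‖ξ‖ = sphereArea d * ∫ y in S ∩ Set.Ioi 0, y ^ (a + d - 1) := by
    rw [integral_fun_norm_addHaar (μ := (volume : Measure (Space d))),
      finrank_euclideanSpace_fin, setIntegral_congr_fun measurableSet_Ioi hfd,
      setIntegral_indicator hS, Set.inter_comm, nsmul_eq_mul, smul_eq_mul, sphereArea, mul_assoc]
  have hmeas : MeasurableSet {ξ : Space d | ‖ξ‖ ∈ S} := measurable_norm hS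
  have hf0 : ∀ y, 0 ≤ y → 0 ≤ f y := fun y hy => by
    by_cases hyS : y ∈ S
    · rw [hf, Set.indicator_of_mem hyS]
      positivity
    · rw [hf, Set.indicator_of_notMem hyS]
  rw [← hval, ofReal_integral_eq_lintegral_ofReal hI
    (Filter.Eventually.of_forall fun ξ => hf0 _ (norm_nonneg ξ)), ← lintegral_indicator hmeas]
  congr 1
  ext ξ
  by_cases hξ : ‖ξ‖ ∈ S
  · rw [Set.indicator_of_mem (show ξ ∈ {ξ : Space d | ‖ξ‖ ∈ S} from hξ), hf,
      Set.indicator_of_mem hξ]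
  · rw [Set.indicator_of_notMem (show ξ ∉ {ξ : Space d | ‖ξ‖ ∈ S} from hξ), hf,
      Set.indicator_of_notMem hξ, ENNReal.ofReal_zero]

/-- After bounding the symbol below by `‖ξ‖ ^ s`, the integrand is a pure power of `‖ξ‖`; polar
coordinates add `d - 1` to the exponent. -/
theorem setLIntegral_div_symbol_le (hd : 1 ≤ d) {s : ℝ} (hs : 0 ≤ s) {S : Set ℝ}
    (hS : MeasurableSet S) {G : Space d → ℂ} {K r : ℝ} (hr : 0 ≤ r) {p : ℕ}
    (hG : ∀ ξ, ‖ξ‖ ∈ S → ‖G ξ‖ ≤ K * (r * ‖ξ‖) ^ p)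
    (hint : IntegrableOn (fun y : ℝ => y ^ (2 * p - 2 * s + d - 1)) (S ∩ Set.Ioi 0)) :
    ∫⁻ ξ in {ξ : Space d | ‖ξ‖ ∈ S}, ‖G ξ / (symbol s ξ : ℂ)‖ₑ ^ 2 ≤
      ENNReal.ofReal (K ^ 2 * sphereArea d *
        (r ^ (2 * p) * ∫ y in S ∩ Set.Ioi 0, y ^ (2 * p - 2 * s + d - 1))) := by
  have : NeZero d := ⟨by omega⟩
  have hmeas : MeasurableSet {ξ : Space d | ‖ξ‖ ∈ S} := measurable_norm hS
  have hle : ∫⁻ ξ in {ξ : Space d | ‖ξ‖ ∈ S}, ‖G ξ / (symbol s ξ : ℂ)‖ₑ ^ 2 ≤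
      ∫⁻ ξ in {ξ : Space d | ‖ξ‖ ∈ S},
        ENNReal.ofReal (K ^ 2 * r ^ (2 * p)) * ENNReal.ofReal (‖ξ‖ ^ (2 * p - 2 * s)) := by
    refine lintegral_mono_ae ?_
    filter_upwards [ae_restrict_mem hmeas,
      ae_restrict_of_ae (Measure.ae_ne (volume : Measure (Space d)) 0)] with ξ hξS hξ
    have hξ0 : 0 < ‖ξ‖ := norm_pos_iff.mpr hξ
    have hsym := norm_rpow_le_symbol hs ξ
    have hpos : 0 < ‖ξ‖ ^ s := Real.rpow_pos_of_pos hξ0 s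
    rw [← ENNReal.ofReal_mul (by positivity), ← ofReal_norm,
      ← ENNReal.ofReal_pow (norm_nonneg _)]
    refine ENNReal.ofReal_le_ofReal ?_
    have hn : ‖G ξ / (symbol s ξ : ℂ)‖ ≤ K * (r * ‖ξ‖) ^ p / ‖ξ‖ ^ s := by
      rw [norm_div, Complex.norm_real, Real.norm_of_nonneg (hpos.le.trans hsym)]
      exact div_le_div₀ ((norm_nonneg _).trans (hG ξ hξS)) (hG ξ hξS) hpos hsym
    calc ‖G ξ / (symbol s ξ : ℂ)‖ ^ 2 ≤ (K * (r * ‖ξ‖) ^ p / ‖ξ‖ ^ s) ^ 2 := by gcongr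
      _ = K ^ 2 * r ^ (2 * p) * ‖ξ‖ ^ (2 * p - 2 * s) := by
        have e : ‖ξ‖ ^ (2 * p - 2 * s) = ‖ξ‖ ^ (2 * p) / (‖ξ‖ ^ s) ^ 2 := by
          rw [Real.rpow_sub hξ0, ← Real.rpow_natCast, ← Real.rpow_natCast, ← Real.rpow_mul hξ0.le]
          push_cast
          rw [mul_comm s 2]
        rw [e, mul_pow r]
        ring
  refine hle.trans ?_
  rw [lintegral_const_mul' _ _ ENNReal.ofReal_ne_top, setLIntegral_norm_rpow hd hS hint,
    ← ENNReal.ofReal_mul (mul_nonneg (sq_nonneg K) (by positivity))]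
  refine ENNReal.ofReal_le_ofReal (le_of_eq ?_)
  ring

theorem eLpNorm_div_symbol_sq_eq (s : ℝ) (G : Space d → ℂ) (R : ℝ) :
    eLpNorm (fun ξ => G ξ / (symbol s ξ : ℂ)) 2 volume ^ 2 =
      (∫⁻ ξ in {ξ : Space d | ‖ξ‖ ∈ Set.Iic R}, ‖G ξ / (symbol s ξ : ℂ)‖ₑ ^ 2) +
        ∫⁻ ξ in {ξ : Space d | ‖ξ‖ ∈ Set.Ioi R}, ‖G ξ / (symbol s ξ : ℂ)‖ₑ ^ 2 := by
  rw [eLpNorm_two_sq, ← lintegral_add_compl (μ := volume) _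
    (measurable_norm (measurableSet_Iic (a := R)) : MeasurableSet {ξ : Space d | ‖ξ‖ ∈ Set.Iic R})]
  congr 3
  ext ξ
  simp

theorem Iic_inter_Ioi_zero (R : ℝ) : Set.Iic R ∩ Set.Ioi 0 = Set.Ioc 0 R := by
  ext y
  simp [and_comm]

theorem Ioi_inter_Ioi_zero {R : ℝ} (hR : 0 ≤ R) : Set.Ioi R ∩ Set.Ioi 0 = Set.Ioi R := by
  rw [Set.Ioi_inter_Ioi, max_eq_left hR]

theorem integrableOn_Ioc_zero_rpow {a R : ℝ} (ha : 0 < a) (hR : 0 ≤ R) :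
    IntegrableOn (fun y : ℝ => y ^ (a - 1)) (Set.Ioc 0 R) :=
  (intervalIntegrable_iff_integrableOn_Ioc_of_le hR).mp
    (intervalIntegral.intervalIntegrable_rpow' (by linarith))

theorem integral_Ioc_zero_rpow {a R : ℝ} (ha : 0 < a) (hR : 0 ≤ R) :
    ∫ y in Set.Ioc 0 R, y ^ (a - 1) = R ^ a / a := by
  rw [← intervalIntegral.integral_of_le hR, integral_rpow (Or.inl (by linarith)),
    sub_add_cancel, Real.zero_rpow ha.ne', sub_zero]

theorem integral_Ioi_rpow_sub_one {a R : ℝ} (ha : a < 0) (hR : 0 < R) :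
    ∫ y in Set.Ioi R, y ^ (a - 1) = R ^ a / -a := by
  rw [integral_Ioi_rpow_of_lt (by linarith) hR, sub_add_cancel, div_neg, neg_div]

/-- The bound for the remainder when `s - d / 2` is not an integer. -/
theorem eLpNorm_expRemainder_one_sq_le (hd : 1 ≤ d) {s : ℝ} (hs : 0 ≤ s) {n : ℕ}
    (hn : (n : ℝ) < s - d / 2) (hn' : s - d / 2 < n + 1) {x : Space d} (hx : x ≠ 0) :
    eLpNorm (fun ξ => expRemainder n (fun _ _ => 1) x ξ / (symbol s ξ : ℂ)) 2 volume ^ 2 ≤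
      (((n + 2) * (2 * Real.pi) ^ (n + 1)) ^ 2 * sphereArea d *
        (1 / (2 * (n + 1) - 2 * (s - d / 2)) + 1 / (2 * (s - d / 2) - 2 * n))).toNNReal *
        ‖‖x‖ ^ (s - d / 2)‖ₑ ^ 2 := by
  set K : ℝ := (n + 2) * (2 * Real.pi) ^ (n + 1) with hK
  set β := s - d / 2 with hβ
  have hr : 0 < ‖x‖ := norm_pos_iff.mpr hx
  -- The two bounds for the remainder cross over at `‖x‖ ‖ξ‖ = 1`.
  set R := ‖x‖⁻¹ with hR
  have hR0 : 0 < R := inv_pos.mpr hr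
  have hA := sphereArea_nonneg d
  have hb : ∀ ξ, _ := fun ξ => norm_expRemainder_le (n := n) (m := n) le_rfl
    (χ := fun _ _ => 1) (x := x) (ξ := ξ) le_rfl (fun _ _ => rfl) (fun k h h' => by omega)
  have e₁ : 2 * ((n + 1 : ℕ) : ℝ) - 2 * s + d - 1 = (2 * (n + 1) - 2 * β) - 1 := by
    push_cast; rw [hβ]; ring
  have e₂ : 2 * (n : ℝ) - 2 * s + d - 1 = (2 * n - 2 * β) - 1 := by rw [hβ]; ring
  -- Scaling: the inner part (`p = n + 1`) and the outer part (`p = n`) contribute the same power of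
  -- `‖x‖`.
  have hpow : ∀ p : ℕ, ‖x‖ ^ (2 * p) * R ^ (2 * p - 2 * β) = (‖x‖ ^ β) ^ 2 := by
    intro p
    rw [hR, Real.inv_rpow hr.le, ← Real.rpow_neg hr.le, ← Real.rpow_natCast,
      ← Real.rpow_add hr, ← Real.rpow_natCast, ← Real.rpow_mul hr.le]
    congr 1
    push_cast
    ring
  have h₁ := setLIntegral_div_symbol_le hd hs (measurableSet_Iic (a := R)) hr.le
    (fun ξ _ => (hb ξ).2) (by
      rw [Iic_inter_Ioi_zero, e₁]
      exact integrableOn_Ioc_zero_rpow (by linarith) hR0.le)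
  have h₂ := setLIntegral_div_symbol_le hd hs (measurableSet_Ioi (a := R)) hr.le
    (fun ξ _ => (hb ξ).1) (by
      rw [Ioi_inter_Ioi_zero hR0.le, e₂]
      exact integrableOn_Ioi_rpow_of_lt (by linarith) hR0)
  rw [Iic_inter_Ioi_zero, e₁, integral_Ioc_zero_rpow (by linarith) hR0.le, ← mul_div_assoc] at h₁
  rw [Ioi_inter_Ioi_zero hR0.le, e₂, integral_Ioi_rpow_sub_one (by linarith) hR0,
    ← mul_div_assoc, hpow] at h₂
  have hpow' := hpow (n + 1)
  push_cast at hpow'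
  rw [hpow'] at h₁
  rw [eLpNorm_div_symbol_sq_eq s _ R]
  have hw : ‖‖x‖ ^ β‖ₑ ^ 2 = ENNReal.ofReal ((‖x‖ ^ β) ^ 2) := by
    rw [Real.enorm_eq_ofReal (by positivity), ENNReal.ofReal_pow (by positivity)]
  have hc₁ : 0 < 2 * ((n : ℝ) + 1) - 2 * β := by linarith
  have hc₂ : 0 < 2 * β - 2 * (n : ℝ) := by linarith
  refine (add_le_add h₁ h₂).trans (le_of_eq ?_)
  rw [hw, ← ENNReal.ofReal_add, ← ENNReal.ofReal, ← ENNReal.ofReal_mul]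
  · congr 1
    rw [neg_sub]
    ring
  · positivity
  · positivity
  · rw [neg_sub]
    positivity

/-- The cutoff that restricts the moments of order `n` to the unit ball. -/
def topCutoff (n k : ℕ) : Space d → ℝ := if k = n then
  (Metric.closedBall 0 1).indicator fun _ => 1 else fun _ => 1

theorem measurable_topCutoff (n k : ℕ) : Measurable (topCutoff (d := d) n k) := by
  unfold topCutoff
  split_ifs
  · exact measurable_const.indicator measurableSet_closedBall
  · exact measurable_const

theorem topCutoff_of_norm_le {n k : ℕ} {ξ : Space d} (h : ‖ξ‖ ≤ 1) : topCutoff n k ξ = 1 := by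
  unfold topCutoff
  split_ifs
  · rw [Set.indicator_of_mem (by simpa using h)]
  · rfl

theorem topCutoff_of_ne {n k : ℕ} (h : k ≠ n) (ξ : Space d) : topCutoff n k ξ = 1 := by
  rw [topCutoff, if_neg h]

theorem topCutoff_self_of_lt {n : ℕ} {ξ : Space d} (h : 1 < ‖ξ‖) : topCutoff n n ξ = 0 := by
  rw [topCutoff, if_pos rfl, Set.indicator_of_notMem (by simpa using h)]

/-- The moments of the Fourier transform with the cutoff `topCutoff n` are finite. -/
theorem integrable_topCutoff_mul_fourier {s : ℝ} (hs : 0 ≤ s) {n : ℕ} (hn1 : 1 ≤ n)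
    (hn : s - d / 2 = n) {V : Space d → ℝ≥0} {ψ : L2 d} (hψ : ψ ∈ formDomain s V) {k : ℕ}
    (hk : k ≤ n) :
    Integrable (fun ξ => ((‖ξ‖ ^ k * topCutoff n k ξ : ℝ) : ℂ) * (𝓕 ψ : L2 d) ξ) volume := by
  have hn0 : (1 : ℝ) ≤ n := by exact_mod_cast hn1
  rcases hk.lt_or_eq with h | rfl
  · have hkn : (k : ℝ) < n := by exact_mod_cast h
    simpa only [topCutoff_of_ne h.ne, mul_one] using
      integrable_norm_pow_mul_fourier hs (by linarith) hψ
  -- At the critical order `k = n` the weight `‖ξ‖ ^ k` is out of reach, but with the cutoff it is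
  -- bounded by `1`, and integrability of `ψ̂` suffices.
  · have hF := integrable_norm_pow_mul_fourier hs (k := 0) (by push_cast; linarith) hψ
    simp only [pow_zero, Complex.ofReal_one, one_mul] at hF
    refine hF.bdd_mul (c := 1) ?_ (Filter.Eventually.of_forall fun ξ => ?_)
    · exact (Complex.measurable_ofReal.comp ((measurable_norm.pow_const k).mul
        (measurable_topCutoff k k))).aestronglyMeasurable
    · rw [Complex.norm_real, Real.norm_eq_abs]
      rcases le_or_gt ‖ξ‖ 1 with h | h
      · rw [topCutoff_of_norm_le h, mul_one, abs_of_nonneg (by positivity)]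
        exact pow_le_one₀ (norm_nonneg _) h
      · rw [topCutoff_self_of_lt h, mul_zero, abs_zero]
        exact zero_le_one

theorem one_le_japanese (x : Space d) : 1 ≤ japanese x := by
  rw [japanese, Real.one_le_sqrt]
  nlinarith [sq_nonneg ‖x‖]

theorem norm_le_japanese (x : Space d) : ‖x‖ ≤ japanese x :=
  Real.le_sqrt_of_sq_le (by linarith)

/-- The bound for the remainder when `s - d / 2` is a positive integer. -/
theorem eLpNorm_expRemainder_topCutoff_sq_le (hd : 1 ≤ d) {s : ℝ} (hs : 0 ≤ s) {n : ℕ}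
    (hn1 : 1 ≤ n) (hn : s - d / 2 = n) (x : Space d) :
    eLpNorm (fun ξ => expRemainder n (topCutoff n) x ξ / (symbol s ξ : ℂ)) 2 volume ^ 2 ≤
      (((n + 2) * (2 * Real.pi) ^ (n + 1)) ^ 2 * sphereArea d).toNNReal *
        ‖japanese x ^ (s - d / 2) * Real.sqrt (1 + Real.log (japanese x))‖ₑ ^ 2 := by
  set K : ℝ := (n + 2) * (2 * Real.pi) ^ (n + 1) with hK
  set J := japanese x with hJ
  have hJ1 : 1 ≤ J := one_le_japanese x
  have hJ0 : 0 < J := by linarith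
  have hlog : 0 ≤ Real.log J := Real.log_nonneg hJ1
  have hA := sphereArea_nonneg d
  have hJi : J⁻¹ ≤ 1 := inv_le_one_of_one_le₀ hJ1
  have hJi0 : 0 < J⁻¹ := inv_pos.mpr hJ0
  have hb : ∀ ξ : Space d, ‖ξ‖ ≤ 1 → _ := fun ξ hξ => norm_expRemainder_le (n := n) (m := n)
    le_rfl (χ := topCutoff n) (x := x) (ξ := ξ) (norm_le_japanese x)
    (fun _ _ => topCutoff_of_norm_le hξ) (fun k h h' => by omega)
  -- Outside the unit ball the term of order `n` is cut off, so the remainder has order `n - 1`; its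
  -- lower power makes the integral converge at infinity.
  have hb' : ∀ ξ : Space d, 1 < ‖ξ‖ → _ := fun ξ hξ => norm_expRemainder_le (n := n) (m := n - 1)
    (Nat.sub_le _ _) (χ := topCutoff n) (x := x) (ξ := ξ) (norm_le_japanese x)
    (fun k hk => topCutoff_of_ne (by omega) ξ)
    (fun k h h' => by rw [show k = n by omega]; exact topCutoff_self_of_lt hξ)
  -- Radial exponents in the three zones `(0, 1/J]`, `(1/J, 1]`, `(1, ∞)`: they are `1`, `-1`, `-3`,
  -- and the middle one integrates to `log J`.
  have e₁ : 2 * ((n + 1 : ℕ) : ℝ) - 2 * s + d - 1 = (2 : ℝ) - 1 := by push_cast; linarith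
  have e₂ : 2 * (n : ℝ) - 2 * s + d - 1 = -1 := by linarith
  have e₃ : 2 * ((n - 1 : ℕ) : ℝ) - 2 * s + d - 1 = (-2 : ℝ) - 1 := by
    rw [Nat.cast_sub hn1]; push_cast; linarith
  have i₂ : Set.Ioc J⁻¹ 1 ∩ Set.Ioi 0 = Set.Ioc J⁻¹ 1 :=
    Set.inter_eq_left.mpr fun y hy => hJi0.trans hy.1
  have h₁ := setLIntegral_div_symbol_le hd hs (measurableSet_Iic (a := J⁻¹)) hJ0.le
    (fun ξ hξ => (hb ξ (le_trans hξ hJi)).2) (by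
      rw [Iic_inter_Ioi_zero, e₁]
      exact integrableOn_Ioc_zero_rpow two_pos hJi0.le)
  have h₂ := setLIntegral_div_symbol_le hd hs (measurableSet_Ioc (a := J⁻¹) (b := 1)) hJ0.le
    (fun ξ hξ => (hb ξ hξ.2).1) (by
      rw [i₂, e₂]
      exact (ContinuousOn.integrableOn_Icc (continuousOn_id.rpow_const fun y hy =>
        Or.inl (hJi0.trans_le hy.1).ne')).mono_set Set.Ioc_subset_Icc_self)
  have h₃ := setLIntegral_div_symbol_le hd hs (measurableSet_Ioi (a := 1)) hJ0.le
    (fun ξ hξ => (hb' ξ hξ).1) (by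
      rw [Ioi_inter_Ioi_zero zero_le_one, e₃]
      exact integrableOn_Ioi_rpow_of_lt (by norm_num) one_pos)
  have hlogint : ∫ y in Set.Ioc J⁻¹ 1, y ^ (-1 : ℝ) = Real.log J := by
    simp only [Real.rpow_neg_one]
    rw [← intervalIntegral.integral_of_le hJi, integral_inv_of_pos hJi0 one_pos, one_div, inv_inv]
  rw [Iic_inter_Ioi_zero, e₁, integral_Ioc_zero_rpow two_pos hJi0.le] at h₁
  rw [i₂, e₂, hlogint] at h₂
  rw [Ioi_inter_Ioi_zero zero_le_one, e₃, integral_Ioi_rpow_sub_one (by norm_num) one_pos] at h₃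
  have hw : ‖J ^ (s - d / 2) * Real.sqrt (1 + Real.log J)‖ₑ ^ 2 =
      ENNReal.ofReal (J ^ (2 * n) * (1 + Real.log J)) := by
    rw [Real.enorm_eq_ofReal (by positivity), ← ENNReal.ofReal_pow (by positivity), mul_pow,
      Real.sq_sqrt (by linarith), hn, Real.rpow_natCast, ← pow_mul, mul_comm n 2]
  have hsplit : {ξ : Space d | ‖ξ‖ ∈ Set.Iic 1} =
      {ξ : Space d | ‖ξ‖ ∈ Set.Iic J⁻¹} ∪ {ξ : Space d | ‖ξ‖ ∈ Set.Ioc J⁻¹ 1} := by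
    ext ξ
    simp only [Set.mem_ofPred_eq, Set.mem_union, Set.mem_Iic, Set.mem_Ioc]
    constructor
    · intro h
      rcases le_or_gt ‖ξ‖ J⁻¹ with h' | h'
      · exact Or.inl h'
      · exact Or.inr ⟨h', h⟩
    · rintro (h | h)
      · exact h.trans hJi
      · exact h.2
  rw [eLpNorm_div_symbol_sq_eq s _ 1, hsplit, hw]
  refine (add_le_add ((lintegral_union_le _ _ _).trans (add_le_add h₁ h₂)) h₃).trans ?_
  rw [← ENNReal.ofReal_add (by positivity) (by positivity),
    ← ENNReal.ofReal_add (by positivity) (by positivity), ← ENNReal.ofReal,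
    ← ENNReal.ofReal_mul (by positivity)]
  refine ENNReal.ofReal_le_ofReal ?_
  rw [← mul_add, ← mul_add]
  gcongr
  -- The inner and outer zones give at most `J ^ (2n) / 2` each, which together supply the `1` in `1
  -- + log J`.
  have t₁ : J ^ (2 * (n + 1)) * (J⁻¹ ^ (2 : ℝ) / 2) = J ^ (2 * n) / 2 := by
    rw [Real.rpow_ofNat]
    field_simp
    ring
  have t₃ : J ^ (2 * (n - 1)) * ((1 : ℝ) ^ (-2 : ℝ) / -(-2)) ≤ J ^ (2 * n) / 2 := by
    rw [Real.one_rpow, neg_neg, ← mul_div_assoc, mul_one]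
    gcongr
    omega
  rw [t₁]
  linarith

end Radial

end FractionalSchrodinger

end

theorem mainTheorem1 (d : ℕ) (hd : 1 ≤ d) (s : ℝ≥0) (hs : (d : ℝ) / 2 < s) :
    ((¬ ∃ k : ℕ, (s : ℝ) - d / 2 = k) →
      ∃ C : ℝ≥0, ∀ V : FractionalSchrodinger.Space d → ℝ≥0, AEMeasurable V volume →
        eLpNorm (fun x => ‖x‖ ^ ((s : ℝ) - d / 2) * FractionalSchrodinger.sqrtPot V x)
          2 volume < ⊤ →
        FractionalSchrodinger.numNegEigenvalues (FractionalSchrodinger.schrodinger s V) ≤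
          ((d + ⌊(s : ℝ) - d / 2⌋₊).choose d : ℝ≥0∞) +
            C * eLpNorm (fun x => ‖x‖ ^ ((s : ℝ) - d / 2) * FractionalSchrodinger.sqrtPot V x)
              2 volume ^ 2) ∧
    ((∃ k : ℕ, 1 ≤ k ∧ (s : ℝ) - d / 2 = k) →
      ∃ C : ℝ≥0, ∀ V : FractionalSchrodinger.Space d → ℝ≥0, AEMeasurable V volume →
        eLpNorm (fun x => FractionalSchrodinger.japanese x ^ ((s : ℝ) - d / 2) *
          Real.sqrt (1 + Real.log (FractionalSchrodinger.japanese x)) *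
            FractionalSchrodinger.sqrtPot V x) 2 volume < ⊤ →
        FractionalSchrodinger.numNegEigenvalues (FractionalSchrodinger.schrodinger s V) ≤
          ((d + ⌊(s : ℝ) - d / 2⌋₊).choose d : ℝ≥0∞) +
            C * eLpNorm (fun x => FractionalSchrodinger.japanese x ^ ((s : ℝ) - d / 2) *
              Real.sqrt (1 + Real.log (FractionalSchrodinger.japanese x)) *
                FractionalSchrodinger.sqrtPot V x) 2 volume ^ 2) := by
  have hs0 : (0 : ℝ) ≤ s := s.2
  constructor
  · intro hnot
    set n := ⌊(s : ℝ) - d / 2⌋₊ with hn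
    have hle : (n : ℝ) ≤ (s : ℝ) - d / 2 := Nat.floor_le (by linarith)
    -- Strictness here is what makes the moments of order `n` absolutely convergent and the outer
    -- radial integral finite.
    have hlt : (n : ℝ) < (s : ℝ) - d / 2 := lt_of_le_of_ne hle fun h => hnot ⟨n, h.symm⟩
    have hlt' : (s : ℝ) - d / 2 < n + 1 := Nat.lt_floor_add_one _
    refine ⟨_, fun V hV _ => FractionalSchrodinger.numNegEigenvalues_le_of_expRemainder hd hs hV
      (fun ψ hψ k hk => ?_) (fun _ => measurable_const) fun x hx =>
        FractionalSchrodinger.eLpNorm_expRemainder_one_sq_le hd hs0 hlt hlt' hx⟩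
    have hkn : (k : ℝ) ≤ n := by exact_mod_cast hk
    simpa only [mul_one] using
      FractionalSchrodinger.integrable_norm_pow_mul_fourier hs0 (by linarith) hψ
  · rintro ⟨n, hn1, hn⟩
    rw [show ⌊(s : ℝ) - d / 2⌋₊ = n by rw [hn, Nat.floor_natCast]]
    refine ⟨_, fun V hV _ => FractionalSchrodinger.numNegEigenvalues_le_of_expRemainder hd hs hV
      (fun ψ hψ k hk => ?_) (FractionalSchrodinger.measurable_topCutoff n) fun x _ =>
        FractionalSchrodinger.eLpNorm_expRemainder_topCutoff_sq_le hd hs0 hn1 hn x⟩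
    exact FractionalSchrodinger.integrable_topCutoff_mul_fourier hs0 hn1 hn hψ hk
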